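/- Let $M$ be an inverse monoid (every $a\in M$ has a unique $b\in M$ with $aba=a$ and $bab=b$) that has a finite inverse monoid presentation: $M\cong \mathrm{Inv}\langle X\mid R\rangle$ with $X$ and $R$ finite, i.e. $M$ is isomorphic to the quotient of the free monoid $\widetilde X^*$ on $\widetilde X=X\cup X^{-1}$ by the congruence generated by $R\subseteq\widetilde X^*\times\widetilde X^*$ together with all pairs $(ww^{-1}w,\,w)$ and $(uu^{-1}vv^{-1},\,vv^{-1}uu^{-1})$, $u,v,w\in\widetilde X^*$. Suppose that $M$ is finite-$\mathcal J$-above: for every $v\in M$ there are only finitely many $u\in M$ such that $v=xuy$ for some $x,y\in M$. For a subset $S\subseteq M$, say that $S$ has solvable membership problem if $M$ is finitely generated as a monoid and, for every finite generating family of $M$, there is an algorithm that, given a word in these generators, decides whether the element of $M$ represented by the word belongs to $S$. Then: 1. for every finite alphabet $A$, every monoid homomorphism $\varphi:A^*\to M$ and every context-free language $L\subseteq A^*$, the set $\varphi(L)$ has solvable membership problem; 2. in particular, every rational subset of $M$ has solvable membership problem (the rational subsets form the smallest family of subsets of $M$ that contains the finite subsets and is closed under binary union, product, and passing from a subset to the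 submonoid it generates); 3. in particular, every finitely generated submonoid of $M$ has solvable membership problem. -/

import Mathlib

open scoped Pointwise

namespace InvMon

universe u

/-- A monoid is inverse if every `a` has exactly one `b` with `a b a = a` and `b a b = b`. -/
def IsInverseMonoid (M : Type u) [Monoid M] : Prop :=
  ∀ a : M, ∃! b : M, a * b * a = a ∧ b * a * b = b

/-- Words over `A ∪ A⁻¹`: the letter `(a, true)` stands for `a`, and `(a, false)` for `a⁻¹`. -/
abbrev InvWord (α : Type u) : Type u := FreeMonoid (α × Bool)

/-- The formal inverse of a word: reverse it and invert every letter. -/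
def InvWord.inv {α : Type u} (w : InvWord α) : InvWord α :=
  FreeMonoid.ofList ((w.toList.map fun x => (x.1, !x.2)).reverse)

/-- The pairs `(w w⁻¹ w, w)` and `(u u⁻¹ v v⁻¹, v v⁻¹ u u⁻¹)`, which generate the Vagner
congruence, together with the pairs of `R`. -/
inductive InvRel {α : Type u} (R : Set (InvWord α × InvWord α)) : InvWord α → InvWord α → Prop
  | regular (w : InvWord α) : InvRel R (w * w.inv * w) w
  | commute (w v : InvWord α) :
      InvRel R (w * w.inv * (v * v.inv)) (v * v.inv * (w * w.inv))
  | rel (w v : InvWord α) (h : (w, v) ∈ R) : InvRel R w v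

/-- The inverse monoid `Inv⟨A | R⟩`: the quotient of the free monoid on `A ∪ A⁻¹` by the
congruence generated by the Vagner congruence and `R`. -/
abbrev InvPresented {α : Type u} (R : Set (InvWord α × InvWord α)) : Type u :=
  PresentedMonoid (InvRel R)

/-- `M` is isomorphic to `Inv⟨A | R⟩` with `A` and `R` finite. -/
def HasFiniteInvPresentation (M : Type u) [Monoid M] : Prop :=
  ∃ (n : ℕ) (R : Set (InvWord (Fin n) × InvWord (Fin n))),
    R.Finite ∧ Nonempty (InvPresented R ≃* M)

/-- `u` is a factor of `v`. -/
def IsFactor {M : Type u} [Monoid M] (u v : M) : Prop :=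
  ∃ x y : M, v = x * u * y

/-- Every element has only finitely many factors. -/
def FiniteJAbove (M : Type u) [Monoid M] : Prop :=
  ∀ v : M, {w : M | IsFactor w v}.Finite

/-- Rational subsets: the smallest family that contains the finite subsets and is closed under
binary union, product, and passing to the submonoid generated by a subset. -/
inductive IsRationalSubset {M : Type u} [Monoid M] : Set M → Prop
  | finite (S : Set M) (hS : S.Finite) : IsRationalSubset S
  | union (S T : Set M) (hS : IsRationalSubset S) (hT : IsRationalSubset T) :
      IsRationalSubset (S ∪ T)
  | mul (S T : Set M) (hS : IsRationalSubset S) (hT : IsRationalSubset T) :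
      IsRationalSubset (S * T)
  | star (S : Set M) (hS : IsRationalSubset S) :
      IsRationalSubset (Submonoid.closure S : Set M)

/-- The membership problem for the subset `S` of the finitely generated monoid `M` is solvable:
elements are given as words in a finite generating family, and whichever such family is used,
there is an algorithm that decides whether the element represented by a given word lies in `S`. -/
def MembershipSolvable {M : Type u} [Monoid M] (S : Set M) : Prop :=
  Monoid.FG M ∧
    ∀ (k : ℕ) (g : Fin k → M), Submonoid.closure (Set.range g) = ⊤ →
      ComputablePred fun w : List (Fin k) => (w.map g).prod ∈ S

/-- The image `φ(L)` of a language `L` under a homomorphism from the free monoid. -/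
def languageImage {A : Type*} {M : Type u} [Monoid M] (φ : FreeMonoid A →* M) (L : Language A) :
    Set M :=
  {m : M | ∃ w ∈ L, φ (FreeMonoid.ofList w) = m}

end InvMon

/-! By Post's theorem it is enough to semi-decide both membership and non-membership. For
membership, enumerate the words generated by the language and the consequences of the presentation
until a generated word is found equal to the input `w` in `M`.

Non-membership rests on finiteness above `𝓙`. If `w` represents `m`, the elements that are not
factors of `m` are closed under multiplication by `M` on either side; collapsing them to one class
leaves a finite quotient in which the class of `m` is `{m}` (`FiniteJAbove.exists_con`). So `m` lies
outside a subset exactly when some finite quotient of `M` separates it from that subset. Finite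
quotients of the free monoid are coded by automata (`exists_autCon_eq`), and a search through the
codes succeeds once a good code can be certified. Two infinite conditions must be cut down to finite
ones. The automaton must respect all Vagner relations, but these depend only on the classes of a
word and of its formal inverse, so a finite list of words suffices (`conGen_invRel_le_iff`). It must
also separate `w` from every generated word, which is certified by a finite set closed under the
productions modulo the congruence (`not_rel_gen_iff`).

Context-free images, rational subsets and finitely generated submonoids are all unions of components
of least solutions of finite systems (`Gen`), so `computablePred_exists_gen` serves all three. -/

namespace InvMon

/-! ### Closure properties of semi-decidable predicates. -/

section SigmaOne

variable {α β γ : Type*} [Primcodable α] [Primcodable β] [Primcodable γ]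

/-- Predicates obtained from a primitive recursive relation by one existential quantifier. -/
def SigmaOne (p : α → Prop) : Prop :=
  ∃ q : ℕ → α → Prop, PrimrecRel q ∧ ∀ a, p a ↔ ∃ n, q n a

namespace SigmaOne

theorem of_eq {p q : α → Prop} (hp : SigmaOne p) (h : ∀ a, p a ↔ q a) : SigmaOne q :=
  (funext fun a => propext (h a) : p = q) ▸ hp

theorem of_primrecPred {p : α → Prop} (hp : PrimrecPred p) : SigmaOne p :=
  ⟨fun _ => p, hp.comp Primrec.snd, fun a => by simp⟩

theorem eq {f g : α → β} (hf : Primrec f) (hg : Primrec g) : SigmaOne fun a => f a = g a :=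
  of_primrecPred (Primrec.eq.comp hf hg)

theorem const (P : Prop) : SigmaOne fun _ : α => P := by
  by_cases h : P
  · exact (eq (Primrec.const 0) (Primrec.const 0)).of_eq fun a => by simp [h]
  · exact (eq (Primrec.const 0) (Primrec.const 1)).of_eq fun a => by simp [h]

theorem comp {p : β → Prop} (hp : SigmaOne p) {f : α → β} (hf : Primrec f) :
    SigmaOne fun a => p (f a) := by
  obtain ⟨q, hq, h⟩ := hp
  exact ⟨fun n a => q n (f a), hq.comp₂ Primrec₂.left (hf.comp Primrec.snd), fun a => h _⟩

/-- Replacing a witness by a bound on a witness makes witnesses persist upwards, so finitely many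
conditions can share one, namely the maximum. -/
theorem exists_monotone {p : α → Prop} (hp : SigmaOne p) :
    ∃ q : ℕ → α → Prop, PrimrecRel q ∧ (∀ m n a, m ≤ n → q m a → q n a) ∧
      ∀ a, p a ↔ ∃ n, q n a := by
  obtain ⟨q, hq, h⟩ := hp
  refine ⟨fun N a => ∃ n ∈ List.range N, q n a, ?_, ?_, ?_⟩
  · exact hq.exists_mem_list.comp₂ (Primrec.list_range.comp Primrec.fst) Primrec₂.right
  · rintro m n a hmn ⟨k, hk, hka⟩
    exact ⟨k, by simp at hk ⊢; omega, hka⟩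
  · intro a
    rw [h]
    exact ⟨fun ⟨n, hn⟩ => ⟨n + 1, n, by simp, hn⟩, fun ⟨_, n, _, hn⟩ => ⟨n, hn⟩⟩

theorem or {p q : α → Prop} (hp : SigmaOne p) (hq : SigmaOne q) :
    SigmaOne fun a => p a ∨ q a := by
  obtain ⟨p', hp', hp⟩ := hp
  obtain ⟨q', hq', hq⟩ := hq
  exact ⟨fun n a => p' n a ∨ q' n a, PrimrecPred.or hp' hq', fun a => by
    simp only [hp, hq, exists_or]⟩

theorem and {p q : α → Prop} (hp : SigmaOne p) (hq : SigmaOne q) :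
    SigmaOne fun a => p a ∧ q a := by
  obtain ⟨p', hp', mp, hp⟩ := hp.exists_monotone
  obtain ⟨q', hq', mq, hq⟩ := hq.exists_monotone
  refine ⟨fun n a => p' n a ∧ q' n a, PrimrecPred.and hp' hq', fun a => ?_⟩
  simp only [hp, hq]
  constructor
  · rintro ⟨⟨m, hm⟩, n, hn⟩
    exact ⟨max m n, mp _ _ _ (le_max_left _ _) hm, mq _ _ _ (le_max_right _ _) hn⟩
  · rintro ⟨n, h₁, h₂⟩
    exact ⟨⟨n, h₁⟩, n, h₂⟩

theorem exists_ {p : α → β → Prop} (hp : SigmaOne fun x : α × β => p x.1 x.2) :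
    SigmaOne fun a => ∃ b, p a b := by
  obtain ⟨q, hq, h⟩ := hp
  have hr : PrimrecRel fun (b : β) (x : ℕ × α) => q x.1.unpair.1 (x.2, b) :=
    hq.comp₂ (Primrec.fst.comp (Primrec.unpair.comp (Primrec.fst.comp Primrec.snd)))
      ((Primrec.snd.comp Primrec.snd).pair Primrec.fst)
  -- The number `n` codes a pair: a stage of the search for `q`, and a code of the candidate `b`.
  refine ⟨fun n a => ∃ b ∈ (Encodable.decode (α := β) n.unpair.2).toList, q n.unpair.1 (a, b),
    ?_, fun a => ?_⟩
  · exact hr.exists_mem_list.comp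
      (Primrec.optionToList.comp (Primrec.decode.comp
        (Primrec.snd.comp (Primrec.unpair.comp Primrec.fst)))) Primrec.id
  · constructor
    · rintro ⟨b, hb⟩
      obtain ⟨n, hn⟩ := (h (a, b)).1 hb
      exact ⟨Nat.pair n (Encodable.encode b), b, by simp, by simpa using hn⟩
    · rintro ⟨n, b, -, hb⟩
      exact ⟨b, (h (a, b)).2 ⟨_, hb⟩⟩

theorem forall_mem {l : α → List β} (hl : Primrec l) {p : α → β → Prop}
    (hp : SigmaOne fun x : α × β => p x.1 x.2) : SigmaOne fun a => ∀ b ∈ l a, p a b := by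
  obtain ⟨q, hq, mq, h⟩ := hp.exists_monotone
  have hr : PrimrecRel fun (b : β) (x : ℕ × α) => q x.1 (x.2, b) :=
    hq.comp₂ (Primrec.fst.comp Primrec.snd) ((Primrec.snd.comp Primrec.snd).pair Primrec.fst)
  refine ⟨fun n a => ∀ b ∈ l a, q n (a, b),
    hr.forall_mem_list.comp (hl.comp Primrec.snd) Primrec.id, fun a => ?_⟩
  beta_reduce
  generalize l a = L
  constructor
  · intro H
    induction L with
    | nil => exact ⟨0, by simp⟩
    | cons b L ih =>
      obtain ⟨m, hm⟩ := (h (a, b)).1 (H b (by simp))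
      obtain ⟨n, hn⟩ := ih fun c hc => H c (by simp [hc])
      refine ⟨max m n, fun c hc => ?_⟩
      rcases List.mem_cons.1 hc with rfl | hc
      · exact mq _ _ _ (le_max_left _ _) hm
      · exact mq _ _ _ (le_max_right _ _) (hn c hc)
  · rintro ⟨n, hn⟩ b hb
    exact (h (a, b)).2 ⟨n, hn b hb⟩

theorem mem {l : α → List β} (hl : Primrec l) {f : α → β} (hf : Primrec f) :
    SigmaOne fun a => f a ∈ l a := by
  have : PrimrecRel fun (L : List β) (b : β) => ∃ c ∈ L, c = b := Primrec.eq.exists_mem_list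
  exact (of_primrecPred (this.comp hl hf)).of_eq fun a => by simp

theorem exists_mem {l : α → List β} (hl : Primrec l) {p : α → β → Prop}
    (hp : SigmaOne fun x : α × β => p x.1 x.2) : SigmaOne fun a => ∃ b ∈ l a, p a b :=
  exists_ ((mem (hl.comp Primrec.fst) Primrec.snd).and hp)

theorem forall_finite {ι : Type*} [Finite ι] {p : α → ι → Prop}
    (hp : ∀ i, SigmaOne fun a => p a i) : SigmaOne fun a => ∀ i, p a i := by
  classical
  have := Fintype.ofFinite ι
  have key : ∀ s : Finset ι, SigmaOne fun a => ∀ i ∈ s, p a i := fun s => by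
    induction s using Finset.induction_on with
    | empty => exact (const True).of_eq fun a => by simp
    | insert i s _ ih => exact ((hp i).and ih).of_eq fun a => by simp
  exact (key Finset.univ).of_eq fun a => by simp

theorem exists_finite {ι : Type*} [Finite ι] {p : α → ι → Prop}
    (hp : ∀ i, SigmaOne fun a => p a i) : SigmaOne fun a => ∃ i, p a i := by
  classical
  have := Fintype.ofFinite ι
  have key : ∀ s : Finset ι, SigmaOne fun a => ∃ i ∈ s, p a i := fun s => by
    induction s using Finset.induction_on with
    | empty => exact (const False).of_eq fun a => by simp
    | insert i s _ ih => exact ((hp i).or ih).of_eq fun a => by simp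
  exact (key Finset.univ).of_eq fun a => by simp

theorem mem_finite {s : Set α} (hs : s.Finite) : SigmaOne fun a => a ∈ s := by
  have := hs.to_subtype
  exact (exists_finite (ι := s) fun i => eq Primrec.id (Primrec.const i.1)).of_eq fun a => by simp

theorem reflTransGen {r : α → α → Prop} (hr : SigmaOne fun x : α × α => r x.1 x.2) :
    SigmaOne fun x : α × α => Relation.ReflTransGen r x.1 x.2 := by
  classical
  -- A chain is stored as a list of edges. Folding ignores any edge that does not start at the
  -- current point, so every list of valid edges traces a genuine path.
  let f : α → α × α → α := fun s p => if p.1 = s then p.2 else s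
  have hf : Primrec₂ f := Primrec.ite
    (Primrec.eq.comp (Primrec.fst.comp Primrec.snd) Primrec.fst)
    (Primrec.snd.comp Primrec.snd) Primrec.fst
  have hfold : Primrec fun y : (α × α) × List (α × α) => y.2.foldl f y.1.1 :=
    Primrec.list_foldl Primrec.snd (Primrec.fst.comp Primrec.fst)
      (hf.comp (Primrec.fst.comp Primrec.snd) (Primrec.snd.comp Primrec.snd)).to₂
  have h : SigmaOne fun x : α × α =>
      ∃ l : List (α × α), (∀ p ∈ l, r p.1 p.2) ∧ l.foldl f x.1 = x.2 :=
    exists_ ((forall_mem Primrec.snd (hr.comp Primrec.snd)).and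
      (eq hfold (Primrec.snd.comp Primrec.fst)))
  refine h.of_eq ?_
  rintro ⟨a, b⟩
  constructor
  · rintro ⟨l, hl, hab⟩
    simp only at hab ⊢
    induction l generalizing a with
    | nil => exact hab ▸ .refl
    | cons p l ih =>
      have := ih (f a p) (fun q hq => hl q (by simp [hq])) hab
      by_cases hp : p.1 = a
      · have h1 := hl p (by simp)
        rw [hp] at h1
        exact .head h1 (by simpa [f, hp] using this)
      · simpa [f, hp] using this
  · intro hab
    simp only at hab ⊢
    induction hab using Relation.ReflTransGen.head_induction_on with
    | refl => exact ⟨[], by simp, rfl⟩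
    | @head a c hac _ ih =>
      obtain ⟨l, hl, hlb⟩ := ih
      refine ⟨(a, c) :: l, ?_, by simpa [f] using hlb⟩
      simpa [hac] using hl

theorem rePred {p : α → Prop} (hp : SigmaOne p) : REPred p := by
  classical
  obtain ⟨q, hq, h⟩ := hp
  have hq' : Computable₂ fun (a : α) (n : ℕ) => decide (q n a) :=
    (hq.decide.comp Primrec.snd Primrec.fst).to_comp
  refine (Partrec.dom_re (Partrec.rfind hq'.partrec₂)).of_eq fun a => ?_
  rw [h, Nat.rfind_dom]
  simp

theorem computablePred {p : α → Prop} (hp : SigmaOne p) (hn : SigmaOne fun a => ¬ p a) :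
    ComputablePred p :=
  ComputablePred.computable_iff_re_compl_re'.2 ⟨hp.rePred, hn.rePred⟩

end SigmaOne

end SigmaOne

/-! ### Finite systems of equations and rational subsets. -/

section Algebraic

variable {M : Type*} [Monoid M]

/-- The least solution of the system `{m} ⊆ S i` for `(i, m) ∈ con`, and
`S j * S k ⊆ S i` for `(i, j, k) ∈ bin`. -/
inductive Gen {I : Type*} (con : Set (I × M)) (bin : Set (I × I × I)) : I → M → Prop
  | con {i : I} {m : M} (h : (i, m) ∈ con) : Gen con bin i m
  | bin {i j k : I} {a b : M} (h : (i, j, k) ∈ bin) (ha : Gen con bin j a)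
      (hb : Gen con bin k b) : Gen con bin i (a * b)

/-- Enlarging a system does not change an old component when no new equation has an old unknown on
its left. This lets systems be glued for unions, products and stars. -/
theorem gen_map_iff {I K : Type*} {con : Set (I × M)} {bin : Set (I × I × I)}
    {con' : Set (K × M)} {bin' : Set (K × K × K)} (f : I → K)
    (hcon : ∀ i m, (f i, m) ∈ con' ↔ (i, m) ∈ con)
    (hbin : ∀ i y z, (f i, y, z) ∈ bin' ↔ ∃ j k, f j = y ∧ f k = z ∧ (i, j, k) ∈ bin)
    {i : I} {m : M} : Gen con' bin' (f i) m ↔ Gen con bin i m := by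
  constructor
  · generalize hx : f i = x
    intro h
    induction h generalizing i with
    | con h => subst hx; exact .con ((hcon _ _).1 h)
    | bin h _ _ iha ihb =>
      subst hx
      obtain ⟨j, k, hj, hk, h⟩ := (hbin _ _ _).1 h
      exact .bin h (iha hj) (ihb hk)
  · intro h
    induction h with
    | con h => exact .con ((hcon _ _).2 h)
    | bin h _ _ iha ihb => exact .bin ((hbin _ _ _).2 ⟨_, _, rfl, rfl, h⟩) iha ihb

/-- Finite unions of components of the least solution of a finite system of equations. -/
def IsAlgebraicSubset (S : Set M) : Prop :=
  ∃ (I : Type) (_ : Finite I) (con : Set (I × M)) (bin : Set (I × I × I)) (start : Set I),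
    con.Finite ∧ S = {m | ∃ i ∈ start, Gen con bin i m}

theorem IsAlgebraicSubset.of_finite {S : Set M} (hS : S.Finite) : IsAlgebraicSubset S := by
  refine ⟨Unit, inferInstance, Prod.mk () '' S, ∅, Set.univ, hS.image _, ?_⟩
  ext m
  constructor
  · exact fun h => ⟨(), trivial, .con ⟨m, h, rfl⟩⟩
  · rintro ⟨i, -, h⟩
    cases h with
    | con h => simpa using h
    | bin h => simp at h

theorem IsAlgebraicSubset.union {S T : Set M} (hS : IsAlgebraicSubset S)
    (hT : IsAlgebraicSubset T) : IsAlgebraicSubset (S ∪ T) := by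
  obtain ⟨I, _, con, bin, s, hcon, rfl⟩ := hS
  obtain ⟨J, _, con', bin', t, hcon', rfl⟩ := hT
  refine ⟨I ⊕ J, inferInstance, Prod.map Sum.inl id '' con ∪ Prod.map Sum.inr id '' con',
    (fun x => (.inl x.1, .inl x.2.1, .inl x.2.2)) '' bin ∪
      (fun x => (.inr x.1, .inr x.2.1, .inr x.2.2)) '' bin',
    Sum.inl '' s ∪ Sum.inr '' t, (hcon.image _).union (hcon'.image _), ?_⟩
  ext m
  simp only [Set.mem_union, Set.mem_ofPred_eq, Set.mem_image, or_and_right, exists_or]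
  refine or_congr ⟨?_, ?_⟩ ⟨?_, ?_⟩
  · rintro ⟨i, hi, h⟩
    exact ⟨_, ⟨i, hi, rfl⟩, (gen_map_iff Sum.inl (by simp) (by simp)).2 h⟩
  · rintro ⟨_, ⟨i, hi, rfl⟩, h⟩
    exact ⟨i, hi, (gen_map_iff Sum.inl (by simp) (by simp)).1 h⟩
  · rintro ⟨i, hi, h⟩
    exact ⟨_, ⟨i, hi, rfl⟩, (gen_map_iff Sum.inr (by simp) (by simp)).2 h⟩
  · rintro ⟨_, ⟨i, hi, rfl⟩, h⟩
    exact ⟨i, hi, (gen_map_iff Sum.inr (by simp) (by simp)).1 h⟩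

theorem IsAlgebraicSubset.mul {S T : Set M} (hS : IsAlgebraicSubset S)
    (hT : IsAlgebraicSubset T) : IsAlgebraicSubset (S * T) := by
  obtain ⟨I, _, con, bin, s, hcon, rfl⟩ := hS
  obtain ⟨J, _, con', bin', t, hcon', rfl⟩ := hT
  let con₁ : Set (Option (I ⊕ J) × M) :=
    Prod.map (some ∘ Sum.inl) id '' con ∪ Prod.map (some ∘ Sum.inr) id '' con'
  let bin₁ : Set (Option (I ⊕ J) × Option (I ⊕ J) × Option (I ⊕ J)) :=
    (fun x => (some (.inl x.1), some (.inl x.2.1), some (.inl x.2.2))) '' bin ∪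
      (fun x => (some (.inr x.1), some (.inr x.2.1), some (.inr x.2.2))) '' bin' ∪
      (fun x => (none, some (.inl x.1), some (.inr x.2))) '' (s ×ˢ t)
  have hl : ∀ i m, Gen con₁ bin₁ (some (.inl i)) m ↔ Gen con bin i m := fun i m =>
    gen_map_iff (fun i => some (Sum.inl i)) (by simp [con₁]) (by simp [bin₁]; grind)
  have hr : ∀ i m, Gen con₁ bin₁ (some (.inr i)) m ↔ Gen con' bin' i m := fun i m =>
    gen_map_iff (fun i => some (Sum.inr i)) (by simp [con₁]) (by simp [bin₁]; grind)
  refine ⟨Option (I ⊕ J), inferInstance, con₁, bin₁, {none},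
    (hcon.image _).union (hcon'.image _), ?_⟩
  ext m
  simp only [Set.mem_mul, Set.mem_ofPred_eq, Set.mem_singleton_iff, exists_eq_left]
  constructor
  · rintro ⟨a, ⟨i, hi, ha⟩, b, ⟨j, hj, hb⟩, rfl⟩
    exact .bin (.inr ⟨(i, j), ⟨hi, hj⟩, rfl⟩) ((hl _ _).2 ha) ((hr _ _).2 hb)
  · intro h
    cases h with
    | con h => simp [con₁] at h
    | @bin _ x y a b h ha hb =>
      simp only [bin₁, Set.mem_union, Set.mem_image, Prod.mk.injEq] at h
      rcases h with (⟨_, _, h, _⟩ | ⟨_, _, h, _⟩) | ⟨⟨i, j⟩, ⟨hi, hj⟩, -, rfl, rfl⟩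
      · cases h
      · cases h
      · exact ⟨a, ⟨i, hi, (hl _ _).1 ha⟩, b, ⟨j, hj, (hr _ _).1 hb⟩, rfl⟩

theorem IsAlgebraicSubset.closure {S : Set M} (hS : IsAlgebraicSubset S) :
    IsAlgebraicSubset (Submonoid.closure S : Set M) := by
  obtain ⟨I, _, con, bin, s, hcon, rfl⟩ := hS
  let con₁ : Set (Option I × M) := insert (none, 1) (Prod.map some id '' con)
  let bin₁ : Set (Option I × Option I × Option I) :=
    (fun x => (some x.1, some x.2.1, some x.2.2)) '' bin ∪ (fun i => (none, some i, none)) '' s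
  have hl : ∀ i m, Gen con₁ bin₁ (some i) m ↔ Gen con bin i m := fun i m =>
    gen_map_iff some (by simp [con₁]) (by simp [bin₁]; grind)
  refine ⟨Option I, inferInstance, con₁, bin₁, {none}, (hcon.image _).insert _, ?_⟩
  ext m
  simp only [SetLike.mem_coe, Set.mem_ofPred_eq, Set.mem_singleton_iff, exists_eq_left]
  constructor
  · intro h
    induction h using Submonoid.closure_induction_left with
    | one => exact .con (.inl rfl)
    | mul_left a ha b _ ih =>
      obtain ⟨i, hi, ha⟩ := ha
      exact .bin (.inr ⟨i, hi, rfl⟩) ((hl _ _).2 ha) ih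
  · generalize hx : (none : Option I) = x
    intro h
    induction h with
    | con h =>
      subst hx
      simp only [con₁, Set.mem_insert_iff, Prod.mk.injEq, true_and] at h
      rcases h with rfl | h
      · exact one_mem _
      · simp at h
    | bin h ha _ _ ihb =>
      subst hx
      simp only [bin₁, Set.mem_union, Set.mem_image, Prod.mk.injEq] at h
      rcases h with ⟨_, _, h, _⟩ | ⟨i, hi, -, rfl, rfl⟩
      · cases h
      · exact mul_mem (Submonoid.subset_closure ⟨i, hi, (hl _ _).1 ha⟩) (ihb rfl)

theorem IsRationalSubset.isAlgebraicSubset {S : Set M} (hS : IsRationalSubset S) :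
    IsAlgebraicSubset S := by
  induction hS with
  | finite S hS => exact .of_finite hS
  | union S T _ _ hS hT => exact hS.union hT
  | mul S T _ _ hS hT => exact hS.mul hT
  | star S _ hS => exact hS.closure

end Algebraic

/-! ### From context-free grammars to systems of equations. -/

section ContextFree

universe v

variable {M : Type*} [Monoid M] {A : Type v}

/-- The elements of `M` represented by the terminal words derivable from a sentential form. -/
inductive SententialValue (φ : FreeMonoid A →* M) (g : ContextFreeGrammar A) :
    List (Symbol A g.NT) → M → Prop
  | nil : SententialValue φ g [] 1
  | terminal (a : A) {l m} (h : SententialValue φ g l m) :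
      SententialValue φ g (.terminal a :: l) (φ (.of a) * m)
  | nonterminal {r l a b} (hr : r ∈ g.rules) (ha : SententialValue φ g r.output a)
      (hb : SententialValue φ g l b) : SententialValue φ g (.nonterminal r.input :: l) (a * b)

namespace SententialValue

variable {φ : FreeMonoid A →* M} {g : ContextFreeGrammar A}

theorem append {l₁ l₂ : List (Symbol A g.NT)} {a b : M} (ha : SententialValue φ g l₁ a)
    (hb : SententialValue φ g l₂ b) : SententialValue φ g (l₁ ++ l₂) (a * b) := by
  induction ha with
  | nil => simpa using hb
  | terminal a _ ih => rw [mul_assoc]; exact .terminal a ih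
  | nonterminal hr ha _ _ ih => rw [mul_assoc]; exact .nonterminal hr ha ih

theorem exists_of_append {l₁ l₂ : List (Symbol A g.NT)} {m : M}
    (h : SententialValue φ g (l₁ ++ l₂) m) :
    ∃ a b, SententialValue φ g l₁ a ∧ SententialValue φ g l₂ b ∧ m = a * b := by
  induction l₁ generalizing m with
  | nil => exact ⟨1, m, .nil, h, by simp⟩
  | cons s l ih =>
    rw [List.cons_append] at h
    cases h with
    | terminal c h =>
      obtain ⟨a, b, ha, hb, rfl⟩ := ih h
      exact ⟨_, b, .terminal c ha, hb, by rw [mul_assoc]⟩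
    | nonterminal hr h₁ h =>
      obtain ⟨a, b, ha, hb, rfl⟩ := ih h
      exact ⟨_, b, .nonterminal hr h₁ ha, hb, by rw [mul_assoc]⟩

theorem of_produces {u v : List (Symbol A g.NT)} (huv : g.Produces u v) {m : M}
    (hv : SententialValue φ g v m) : SententialValue φ g u m := by
  obtain ⟨r, hr, huv⟩ := huv
  obtain ⟨p, q, rfl, rfl⟩ := huv.exists_parts
  rw [List.append_assoc] at hv ⊢
  obtain ⟨a, n, ha, hn, rfl⟩ := hv.exists_of_append
  obtain ⟨b, c, hb, hc, rfl⟩ := hn.exists_of_append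
  exact ha.append (.nonterminal hr hb hc)

theorem of_derives {u : List (Symbol A g.NT)} {w : List A}
    (h : g.Derives u (w.map Symbol.terminal)) : SententialValue φ g u (φ (.ofList w)) := by
  induction h using Relation.ReflTransGen.head_induction_on with
  | refl =>
    induction w with
    | nil => simpa using SententialValue.nil
    | cons a w ih =>
      rw [FreeMonoid.ofList_cons, map_mul]
      exact .terminal a ih
  | head h _ ih => exact of_produces h ih

end SententialValue

/-- The unknowns are the suffixes of the initial symbol, of the right-hand sides and of the single
terminals. A nonempty suffix is its first symbol times a shorter suffix, and a leading nonterminal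
is expanded to a right-hand side, so all equations are binary and finitely many unknowns suffice. -/
theorem exists_gen_of_isContextFree [Finite A] (φ : FreeMonoid A →* M) {L : Language A}
    (hL : L.IsContextFree) :
    ∃ (I : Type v) (_ : Finite I) (con : Set (I × M)) (bin : Set (I × I × I)) (start : Set I),
      con.Finite ∧ languageImage φ L = {m | ∃ i ∈ start, Gen con bin i m} := by
  obtain ⟨g, rfl⟩ := hL
  let Γ : Set (List (Symbol A g.NT)) :=
    {[.nonterminal g.initial]} ∪ ContextFreeRule.output '' (g.rules : Set _) ∪
      Set.range fun a => [.terminal a]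
  have hΓ : Γ.Finite := ((Set.finite_singleton _).union (g.rules.finite_toSet.image _)).union
    (Set.finite_range _)
  let Δ : Set (List (Symbol A g.NT)) := ⋃ l ∈ Γ, {s | s <:+ l}
  have hΔ : Δ.Finite := hΓ.biUnion fun l _ => l.tails.finite_toSet.subset fun s hs => by
    simpa using hs
  have hsub : ∀ l ∈ Γ, l ∈ Δ := fun l hl => Set.mem_biUnion hl (List.suffix_refl l)
  have htail : ∀ s l, s :: l ∈ Δ → l ∈ Δ := fun s l h => by
    obtain ⟨t, ht, h⟩ := Set.mem_iUnion₂.1 h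
    exact Set.mem_biUnion ht ((List.suffix_cons s l).trans h)
  let con : Set (Δ × M) :=
    {x | (x.1.1 = [] ∧ x.2 = 1) ∨ ∃ a, x.1.1 = [.terminal a] ∧ x.2 = φ (.of a)}
  let bin : Set (Δ × Δ × Δ) :=
    {x | (∃ a, x.1.1 = .terminal a :: x.2.2.1 ∧ x.2.1.1 = [.terminal a]) ∨
      ∃ r ∈ g.rules, x.1.1 = .nonterminal r.input :: x.2.2.1 ∧ x.2.1.1 = r.output}
  have : Finite Δ := hΔ
  have sound : ∀ i m, Gen con bin i m →
      ∃ w : List A, g.Derives i.1 (w.map .terminal) ∧ φ (.ofList w) = m := by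
    intro i m h
    induction h with
    | con h =>
      rcases h with ⟨h₁, h₂⟩ | ⟨a, h₁, h₂⟩
      · simp only at h₁ h₂
        exact ⟨[], by rw [h₁]; exact .refl _, by rw [h₂]; exact map_one φ⟩
      · simp only at h₁ h₂
        exact ⟨[a], by rw [h₁]; exact .refl _, by rw [h₂]; rfl⟩
    | @bin i j k a b h _ _ iha ihb =>
      obtain ⟨u, hu, rfl⟩ := iha
      obtain ⟨v, hv, rfl⟩ := ihb
      refine ⟨u ++ v, ?_, by rw [FreeMonoid.ofList_append, map_mul]⟩
      have key : g.Derives (j.1 ++ k.1) ((u ++ v).map .terminal) := by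
        rw [List.map_append]
        exact (hu.append_right _).trans (hv.append_left _)
      rcases h with ⟨a, h₁, h₂⟩ | ⟨r, hr, h₁, h₂⟩
      · simp only at h₁ h₂
        rw [h₁]
        rwa [h₂] at key
      · simp only at h₁ h₂
        rw [h₁]
        rw [h₂] at key
        exact .head ⟨r, hr, .head _⟩ key
  have complete : ∀ l m, SententialValue φ g l m → ∀ h : l ∈ Δ, Gen con bin ⟨l, h⟩ m := by
    intro l m hl
    induction hl with
    | nil => exact fun h => .con (.inl ⟨rfl, rfl⟩)
    | @terminal a l m _ ih =>
      intro h
      exact .bin (j := ⟨[.terminal a], hsub _ (.inr ⟨a, rfl⟩)⟩) (k := ⟨l, htail _ _ h⟩)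
        (.inl ⟨a, rfl, rfl⟩) (.con (.inr ⟨a, rfl, rfl⟩)) (ih _)
    | @nonterminal r l a b hr _ _ iha ihb =>
      intro h
      exact .bin (j := ⟨r.output, hsub _ (.inl (.inr ⟨r, hr, rfl⟩))⟩) (k := ⟨l, htail _ _ h⟩)
        (.inr ⟨r, hr, rfl, rfl⟩) (iha _) (ihb _)
  have hinit : [.nonterminal g.initial] ∈ Δ := hsub _ (.inl (.inl rfl))
  refine ⟨Δ, hΔ, con, bin, {⟨_, hinit⟩}, ?_, ?_⟩
  · refine (Set.finite_univ.prod ((Set.finite_singleton (1 : M)).union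
      (Set.finite_range fun a => φ (.of a)))).subset ?_
    rintro ⟨i, m⟩ (⟨-, h⟩ | ⟨a, -, h⟩)
    · exact ⟨trivial, .inl h⟩
    · exact ⟨trivial, .inr ⟨a, h.symm⟩⟩
  · ext m
    simp only [languageImage, Set.mem_ofPred_eq, Set.mem_singleton_iff, exists_eq_left]
    constructor
    · rintro ⟨w, hw, rfl⟩
      exact complete _ _ (.of_derives hw) hinit
    · exact sound _ m

end ContextFree

/-! ### Words as codable objects. -/

section FreeMonoidCoding

variable {X : Type*} [Primcodable X] {α : Type*} [Primcodable α]

instance : Primcodable (FreeMonoid X) := inferInstanceAs (Primcodable (List X))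

theorem primrec_ofList : Primrec (FreeMonoid.ofList : List X → FreeMonoid X) := Primrec.id

theorem primrec_toList : Primrec (FreeMonoid.toList : FreeMonoid X → List X) := Primrec.id

theorem primrec_freeMonoid_mul {f g : α → FreeMonoid X} (hf : Primrec f) (hg : Primrec g) :
    Primrec fun a => f a * g a :=
  Primrec.list_append.comp hf hg

end FreeMonoidCoding

/-! ### Finite-index congruences coded by automata. -/

section Automaton

variable {X : Type*} [Primcodable X]

/-- The transition function of the automaton with states `0, …, c.1` and transition table `c.2`. -/
def autStep (c : ℕ × List ℕ) (s : ℕ) (x : X) : ℕ :=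
  c.2.getD (Nat.pair s (Encodable.encode x)) 0 % (c.1 + 1)

/-- The state reached from `s` by reading a word. -/
def autRun (c : ℕ × List ℕ) (s : ℕ) (u : FreeMonoid X) : ℕ :=
  u.toList.foldl (autStep c) s

theorem autRun_one (c : ℕ × List ℕ) (s : ℕ) : autRun c s (1 : FreeMonoid X) = s := rfl

theorem autRun_mul (c : ℕ × List ℕ) (s : ℕ) (u v : FreeMonoid X) :
    autRun c s (u * v) = autRun c (autRun c s u) v := by
  simp [autRun, FreeMonoid.toList_mul, List.foldl_append]

theorem autRun_of_mul (c : ℕ × List ℕ) (s : ℕ) (x : X) (v : FreeMonoid X) :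
    autRun c s (FreeMonoid.of x * v) = autRun c (autStep c s x) v :=
  autRun_mul c s _ v

/-- The remainder taken in `autStep` keeps states in range whatever the table contains, so every
pair in `ℕ × List ℕ` is a valid code and enumeration needs no check. -/
theorem autRun_lt (c : ℕ × List ℕ) {s : ℕ} (hs : s < c.1 + 1) (u : FreeMonoid X) :
    autRun c s u < c.1 + 1 := by
  induction u using FreeMonoid.inductionOn' generalizing s with
  | one => exact hs
  | of_mul x u ih =>
    rw [autRun_of_mul]
    exact ih (Nat.mod_lt _ (Nat.succ_pos _))

/-- Two words are related if they act in the same way on the states of an automaton. -/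
def autCon (c : ℕ × List ℕ) : Con (FreeMonoid X) where
  r u v := ∀ s < c.1 + 1, autRun c s u = autRun c s v
  iseqv := ⟨fun _ _ _ => rfl, fun h s hs => (h s hs).symm, fun h h' s hs =>
    (h s hs).trans (h' s hs)⟩
  mul' := fun h h' s hs => by
    rw [autRun_mul, autRun_mul, h s hs, h' _ (autRun_lt c hs _)]

theorem autCon_iff {c : ℕ × List ℕ} {u v : FreeMonoid X} :
    autCon c u v ↔ ∀ s < c.1 + 1, autRun c s u = autRun c s v := Iff.rfl

instance finite_quotient_autCon (c : ℕ × List ℕ) :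
    Finite (autCon c : Con (FreeMonoid X)).Quotient := by
  let f : FreeMonoid X → Fin (c.1 + 1) → Fin (c.1 + 1) := fun u s => ⟨_, autRun_lt c s.2 u⟩
  have hf : ∀ u v, autCon c u v ↔ f u = f v := fun u v => by
    simp only [autCon_iff, f, funext_iff, Fin.forall_iff, Fin.mk.injEq]
  refine Finite.of_injective
    (Quotient.lift f fun u v h => (hf u v).1 h : (autCon c).Quotient → _) ?_
  rintro ⟨u⟩ ⟨v⟩ h
  exact Quotient.sound ((hf u v).2 h)

/-- The automaton is the right Cayley graph of the quotient: the states are the classes, and a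
letter acts by right multiplication. -/
theorem exists_autCon_eq [Finite X] (d : Con (FreeMonoid X)) [Finite d.Quotient] :
    ∃ c, autCon c = d := by
  classical
  obtain ⟨n, ⟨e⟩⟩ := Finite.exists_equiv_fin d.Quotient
  obtain ⟨N, rfl⟩ : ∃ N, n = N + 1 := ⟨n - 1, by have := (e 1).pos; omega⟩
  let f : ℕ → ℕ := fun k =>
    if h : k.unpair.1 < N + 1 then
      ((Encodable.decode (α := X) k.unpair.2).map fun x =>
        (e (e.symm ⟨_, h⟩ * (FreeMonoid.of x : FreeMonoid X)) : ℕ)).getD 0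
    else 0
  -- `B` is a table length large enough to hold an entry for every state and letter.
  obtain ⟨B, hB⟩ : ∃ B, ∀ y : Fin (N + 1) × X, Nat.pair y.1 (Encodable.encode y.2) < B := by
    obtain ⟨B, hB⟩ := (Set.finite_range fun y : Fin (N + 1) × X =>
      Nat.pair y.1 (Encodable.encode y.2)).bddAbove
    exact ⟨B + 1, fun y => Nat.lt_succ_of_le (hB ⟨y, rfl⟩)⟩
  let c : ℕ × List ℕ := (N, (List.range B).map f)
  have hstep : ∀ (q : d.Quotient) (x : X),
      autStep c (e q) x = e (q * (FreeMonoid.of x : FreeMonoid X)) := fun q x => by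
    have h := hB (e q, x)
    simp only at h
    have hfv : f (Nat.pair (e q) (Encodable.encode x)) =
        e (q * (FreeMonoid.of x : FreeMonoid X)) := by
      have := Nat.lt_succ_iff.1 (e q).is_lt
      simp [f, this.not_gt]
    have : ((List.range B).map f).getD (Nat.pair (e q) (Encodable.encode x)) 0 =
        e (q * (FreeMonoid.of x : FreeMonoid X)) := by
      rw [← hfv, List.getD_eq_getElem?_getD, List.getElem?_map, List.getElem?_range h]
      rfl
    rw [autStep, this]
    exact Nat.mod_eq_of_lt (Fin.is_lt _)
  have hrun : ∀ (u : FreeMonoid X) (q : d.Quotient), autRun c (e q) u = e (q * u) := fun u => by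
    induction u using FreeMonoid.inductionOn' with
    | one => intro q; rw [autRun_one, Con.coe_one, mul_one]
    | of_mul x u ih => intro q; rw [autRun_of_mul, hstep, ih, Con.coe_mul, mul_assoc]
  refine ⟨c, Con.ext fun u v => ?_⟩
  rw [autCon_iff, ← Con.eq]
  constructor
  · intro h
    -- Reading a word from the class of `1` ends at the class of the word.
    have := h (e 1) (e 1).2
    rw [hrun, hrun, one_mul, one_mul] at this
    exact e.injective (Fin.ext this)
  · intro h s hs
    have := hrun u (e.symm ⟨s, hs⟩)
    have h' := hrun v (e.symm ⟨s, hs⟩)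
    rw [e.apply_symm_apply] at this h'
    rw [this, h', h]

variable {α : Type*} [Primcodable α]

theorem primrec_autRun {c : α → ℕ × List ℕ} {s : α → ℕ} {u : α → FreeMonoid X}
    (hc : Primrec c) (hs : Primrec s) (hu : Primrec u) :
    Primrec fun a => autRun (c a) (s a) (u a) := by
  have hca : Primrec fun y : α × ℕ × X => c y.1 := hc.comp Primrec.fst
  have hstep : Primrec fun y : α × ℕ × X => autStep (c y.1) y.2.1 y.2.2 :=
    Primrec.nat_mod.comp
      ((Primrec.list_getD 0).comp (Primrec.snd.comp hca)
        (Primrec₂.natPair.comp (Primrec.fst.comp Primrec.snd)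
          (Primrec.encode.comp (Primrec.snd.comp Primrec.snd))))
      (Primrec.succ.comp (Primrec.fst.comp hca))
  exact Primrec.list_foldl (h := fun a y => autStep (c a) y.1 y.2) (primrec_toList.comp hu) hs hstep

theorem primrecPred_autCon {c : α → ℕ × List ℕ} {u v : α → FreeMonoid X}
    (hc : Primrec c) (hu : Primrec u) (hv : Primrec v) :
    PrimrecPred fun a => autCon (c a) (u a) (v a) := by
  have h : PrimrecRel fun (s : ℕ) (a : α) => autRun (c a) s (u a) = autRun (c a) s (v a) :=
    Primrec.eq.comp
      (primrec_autRun (hc.comp Primrec.snd) Primrec.fst (hu.comp Primrec.snd))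
      (primrec_autRun (hc.comp Primrec.snd) Primrec.fst (hv.comp Primrec.snd))
  refine (h.forall_mem_list.comp
    (Primrec.list_range.comp (Primrec.succ.comp (Primrec.fst.comp hc))) Primrec.id).of_eq
    fun a => ?_
  simp [autCon_iff]

end Automaton

/-! ### Enumerating the consequences of a presentation. -/

section WordProblem

variable {X : Type*}

/-- One application of a relation, in either direction, inside a word. -/
def RewriteStep (r : FreeMonoid X → FreeMonoid X → Prop) (u v : FreeMonoid X) : Prop :=
  ∃ z : (FreeMonoid X × FreeMonoid X) × FreeMonoid X × FreeMonoid X,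
    (r z.1.1 z.1.2 ∨ r z.1.2 z.1.1) ∧ u = z.2.1 * z.1.1 * z.2.2 ∧ v = z.2.1 * z.1.2 * z.2.2

theorem conGen_iff_reflTransGen {r : FreeMonoid X → FreeMonoid X → Prop} {u v : FreeMonoid X} :
    conGen r u v ↔ Relation.ReflTransGen (RewriteStep r) u v := by
  constructor
  · intro h
    induction h with
    | of u v h => exact .single ⟨((u, v), 1, 1), .inl h, by simp, by simp⟩
    | refl => exact .refl
    | symm _ ih =>
      have : Std.Symm (RewriteStep r) :=
        ⟨fun _ _ ⟨z, h, hu, hv⟩ => ⟨((z.1.2, z.1.1), z.2), h.symm, hv, hu⟩⟩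
      exact (Relation.ReflTransGen.stdSymm (r := RewriteStep r)).symm _ _ ih
    | trans _ _ ih ih' => exact ih.trans ih'
    | @mul w x y z _ _ ih ih' =>
      refine .trans (b := x * y) (ih.lift (· * y) ?_) (ih'.lift (x * ·) ?_)
      · rintro _ _ ⟨⟨l, p, q⟩, h, rfl, rfl⟩
        exact ⟨⟨l, p, q * y⟩, h, by simp [mul_assoc], by simp [mul_assoc]⟩
      · rintro _ _ ⟨⟨l, p, q⟩, h, rfl, rfl⟩
        exact ⟨⟨l, x * p, q⟩, h, by simp [mul_assoc], by simp [mul_assoc]⟩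
  · intro h
    induction h with
    | refl => exact (conGen r).refl _
    | tail _ h ih =>
      obtain ⟨⟨⟨l, l'⟩, p, q⟩, h, rfl, rfl⟩ := h
      have : conGen r l l' := h.elim (.of _ _) fun h => .symm (.of _ _ h)
      exact ih.trans (((conGen r).mul ((conGen r).refl p) this).mul ((conGen r).refl q))

variable [Primcodable X]

theorem sigmaOne_conGen {r : FreeMonoid X → FreeMonoid X → Prop}
    (hr : SigmaOne fun x : FreeMonoid X × FreeMonoid X => r x.1 x.2) :
    SigmaOne fun x : FreeMonoid X × FreeMonoid X => conGen r x.1 x.2 := by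
  have h1 : Primrec fun y : (FreeMonoid X × FreeMonoid X) ×
      (FreeMonoid X × FreeMonoid X) × FreeMonoid X × FreeMonoid X => y.2.1 :=
    Primrec.fst.comp Primrec.snd
  have h2 : Primrec fun y : (FreeMonoid X × FreeMonoid X) ×
      (FreeMonoid X × FreeMonoid X) × FreeMonoid X × FreeMonoid X => y.2.2 :=
    Primrec.snd.comp Primrec.snd
  have hstep : SigmaOne fun x : FreeMonoid X × FreeMonoid X => RewriteStep r x.1 x.2 := by
    refine SigmaOne.exists_ (((hr.comp h1).or (hr.comp
      ((Primrec.snd.comp h1).pair (Primrec.fst.comp h1)))).and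
      ((SigmaOne.eq (Primrec.fst.comp Primrec.fst) ?_).and
        (SigmaOne.eq (Primrec.snd.comp Primrec.fst) ?_)))
    · exact primrec_freeMonoid_mul (primrec_freeMonoid_mul (Primrec.fst.comp h2)
        (Primrec.fst.comp h1)) (Primrec.snd.comp h2)
    · exact primrec_freeMonoid_mul (primrec_freeMonoid_mul (Primrec.fst.comp h2)
        (Primrec.snd.comp h1)) (Primrec.snd.comp h2)
  exact hstep.reflTransGen.of_eq fun x => conGen_iff_reflTransGen.symm

end WordProblem

/-! ### Enumerating and separating the words of a system. -/

section Systems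

variable {I : Type*}

theorem gen_image_iff {N M : Type*} [Monoid N] [Monoid M] (π : N →* M) {con : Set (I × N)}
    {bin : Set (I × I × I)} {i : I} {m : M} :
    Gen (Prod.map id π '' con) bin i m ↔ ∃ u, Gen con bin i u ∧ π u = m := by
  constructor
  · intro h
    induction h with
    | con h =>
      obtain ⟨⟨i, u⟩, h, he⟩ := h
      obtain ⟨rfl, rfl⟩ := Prod.mk.inj he
      exact ⟨u, .con h, rfl⟩
    | bin h _ _ iha ihb =>
      obtain ⟨u, hu, rfl⟩ := iha
      obtain ⟨v, hv, rfl⟩ := ihb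
      exact ⟨u * v, .bin h hu hv, map_mul _ _ _⟩
  · rintro ⟨u, h, rfl⟩
    induction h with
    | con h => exact .con ⟨_, h, rfl⟩
    | bin h _ _ iha ihb => rw [map_mul]; exact .bin h iha ihb

variable {X : Type*}

/-- One step of the leftmost derivations of a system of equations: the unknowns still to be
expanded, and the word produced so far. -/
def LeftmostStep (con : Set (I × FreeMonoid X)) (bin : Set (I × I × I))
    (x y : List I × FreeMonoid X) : Prop :=
  (∃ z : (I × FreeMonoid X) × List I,
    z.1 ∈ con ∧ x.1 = z.1.1 :: z.2 ∧ y = (z.2, x.2 * z.1.2)) ∨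
  ∃ z : (I × I × I) × List I,
    z.1 ∈ bin ∧ x.1 = z.1.1 :: z.2 ∧ y = (z.1.2.1 :: z.1.2.2 :: z.2, x.2)

theorem gen_iff_reflTransGen {con : Set (I × FreeMonoid X)} {bin : Set (I × I × I)} {i : I}
    {u : FreeMonoid X} :
    Gen con bin i u ↔ Relation.ReflTransGen (LeftmostStep con bin) ([i], 1) ([], u) := by
  constructor
  · intro h
    suffices ∀ l v, Relation.ReflTransGen (LeftmostStep con bin) (i :: l, v) (l, v * u) by
      simpa using this [] 1
    induction h with
    | @con i u h => exact fun l v => .single (.inl ⟨((i, u), l), h, rfl, rfl⟩)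
    | @bin i j k a b h _ _ iha ihb =>
      intro l v
      refine .head (.inr ⟨((i, j, k), l), h, rfl, rfl⟩) ((iha _ _).trans ?_)
      rw [← mul_assoc]
      exact ihb _ _
  -- For the induction, the pending unknowns may form any list: each produces its own factor of the
  -- final word.
  · suffices ∀ x y, Relation.ReflTransGen (LeftmostStep con bin) x y → y.1 = [] →
        ∃ ms, List.Forall₂ (Gen con bin) x.1 ms ∧ y.2 = x.2 * ms.prod by
      intro h
      obtain ⟨ms, hms, hu⟩ := this _ _ h rfl
      obtain ⟨m, _, hm, hnil, rfl⟩ := List.forall₂_cons_left_iff.1 hms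
      obtain rfl := List.forall₂_nil_left_iff.1 hnil
      simp only [List.prod_cons, List.prod_nil, mul_one, one_mul] at hu
      exact hu ▸ hm
    intro x y h hy
    induction h using Relation.ReflTransGen.head_induction_on with
    | refl => exact ⟨[], by simp [hy], by simp⟩
    | @head x z h _ ih =>
      obtain ⟨ms, hms, hym⟩ := ih
      rcases x with ⟨l, v⟩
      rcases h with ⟨⟨⟨i, c⟩, l⟩, h, rfl, rfl⟩ | ⟨⟨⟨i, j, k⟩, l⟩, h, rfl, rfl⟩
      · exact ⟨c :: ms, .cons (.con h) hms, by simp [hym, mul_assoc]⟩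
      · obtain ⟨a, as, ha, has, rfl⟩ := List.forall₂_cons_left_iff.1 hms
        obtain ⟨b, bs, hb, hbs, rfl⟩ := List.forall₂_cons_left_iff.1 has
        exact ⟨(a * b) :: bs, .cons (.bin h ha hb) hbs, by simp [hym, mul_assoc]⟩

theorem exists_list_representatives {α β : Type*} [Finite β] (p : α → Prop) (f : α → β) :
    ∃ l : List α, (∀ a ∈ l, p a) ∧ ∀ a, p a → ∃ b ∈ l, f b = f a := by
  choose g hg using fun b : {b // ∃ a, p a ∧ f a = b} => b.2
  refine ⟨(Set.finite_range g).toFinset.toList, ?_, fun a ha => ⟨g ⟨f a, a, ha, rfl⟩, ?_, ?_⟩⟩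
  · intro a ha
    obtain ⟨b, rfl⟩ : ∃ b, g b = a := by simpa using ha
    exact (hg b).1
  · simp
  · exact (hg _).2

/-- A congruence separates a word from the words of a system of equations if and only if some
finite set of words is closed under the system up to the congruence and avoids that word. -/
theorem not_rel_gen_iff [Finite I] {con : Set (I × FreeMonoid X)} {bin : Set (I × I × I)} {start : Set I}
    (d : Con (FreeMonoid X)) [Finite d.Quotient] (w : FreeMonoid X) :
    (∀ i ∈ start, ∀ u, Gen con bin i u → ¬ d u w) ↔
      ∃ Q : List (I × FreeMonoid X),
        (∀ c : con, ∃ y ∈ Q, y.1 = c.1.1 ∧ d y.2 c.1.2) ∧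
        (∀ b : bin, ∀ y ∈ Q, ∀ z ∈ Q, y.1 ≠ b.1.2.1 ∨ z.1 ≠ b.1.2.2 ∨
          ∃ t ∈ Q, t.1 = b.1.1 ∧ d t.2 (y.2 * z.2)) ∧
        ∀ y ∈ Q, y.1 ∉ start ∨ ¬ d y.2 w := by
  constructor
  · intro h
    -- `Q` picks one generated word for each attained pair of unknown and class.
    obtain ⟨Q, hQ, hrep⟩ := exists_list_representatives
      (fun y : I × FreeMonoid X => Gen con bin y.1 y.2)
      (fun y => (y.1, (y.2 : d.Quotient)))
    have hrep' : ∀ i u, Gen con bin i u → ∃ y ∈ Q, y.1 = i ∧ d y.2 u := fun i u hu => by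
      obtain ⟨y, hy, he⟩ := hrep (i, u) hu
      exact ⟨y, hy, (Prod.mk.inj he).1, (Con.eq d).1 (Prod.mk.inj he).2⟩
    refine ⟨Q, fun c => hrep' _ _ (.con c.2), fun b y hy z hz => ?_, fun y hy => ?_⟩
    · rcases b with ⟨⟨i, j, k⟩, hb⟩
      by_cases h1 : y.1 = j
      · by_cases h2 : z.1 = k
        · exact .inr (.inr (hrep' _ _ (.bin hb (h1 ▸ hQ y hy) (h2 ▸ hQ z hz))))
        · exact .inr (.inl h2)
      · exact .inl h1
    · by_cases hs : y.1 ∈ start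
      · exact .inr (h _ hs _ (hQ y hy))
      · exact .inl hs
  · rintro ⟨Q, hcon, hbin, hstart⟩ i hi u hu huw
    have key : ∃ y ∈ Q, y.1 = i ∧ d y.2 u := by
      clear hi huw
      induction hu with
      | con h => exact hcon ⟨_, h⟩
      | bin h _ _ iha ihb =>
        obtain ⟨y, hy, rfl, hya⟩ := iha
        obtain ⟨z, hz, rfl, hzb⟩ := ihb
        rcases hbin ⟨_, h⟩ y hy z hz with h | h | ⟨t, ht, hti, htd⟩
        · exact absurd rfl h
        · exact absurd rfl h
        · exact ⟨t, ht, hti, d.trans htd (d.mul hya hzb)⟩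
    obtain ⟨y, hy, rfl, hyu⟩ := key
    exact (hstart y hy).elim (fun h => h hi) fun h => h (d.trans hyu huw)

variable [Primcodable I] [Finite I] [Primcodable X]

theorem sigmaOne_gen {con : Set (I × FreeMonoid X)} (hcon : con.Finite)
    (bin : Set (I × I × I)) :
    SigmaOne fun x : I × FreeMonoid X => Gen con bin x.1 x.2 := by
  have hstep : SigmaOne fun x : (List I × FreeMonoid X) × (List I × FreeMonoid X) =>
      LeftmostStep con bin x.1 x.2 := by
    refine .or (SigmaOne.exists_ ?_) (SigmaOne.exists_ ?_)
    · have h1 : Primrec fun y : ((List I × FreeMonoid X) × (List I × FreeMonoid X)) ×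
          (I × FreeMonoid X) × List I => y.1.1 := Primrec.fst.comp Primrec.fst
      have h2 : Primrec fun y : ((List I × FreeMonoid X) × (List I × FreeMonoid X)) ×
          (I × FreeMonoid X) × List I => y.2.1 := Primrec.fst.comp Primrec.snd
      have h3 : Primrec fun y : ((List I × FreeMonoid X) × (List I × FreeMonoid X)) ×
          (I × FreeMonoid X) × List I => y.2.2 := Primrec.snd.comp Primrec.snd
      exact ((SigmaOne.mem_finite hcon).comp h2).and
        ((SigmaOne.eq (Primrec.fst.comp h1)
          (Primrec.list_cons.comp (Primrec.fst.comp h2) h3)).and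
        (SigmaOne.eq (Primrec.snd.comp Primrec.fst)
          (h3.pair (primrec_freeMonoid_mul (Primrec.snd.comp h1) (Primrec.snd.comp h2)))))
    · have h1 : Primrec fun y : ((List I × FreeMonoid X) × (List I × FreeMonoid X)) ×
          (I × I × I) × List I => y.1.1 := Primrec.fst.comp Primrec.fst
      have h2 : Primrec fun y : ((List I × FreeMonoid X) × (List I × FreeMonoid X)) ×
          (I × I × I) × List I => y.2.1 := Primrec.fst.comp Primrec.snd
      have h3 : Primrec fun y : ((List I × FreeMonoid X) × (List I × FreeMonoid X)) ×
          (I × I × I) × List I => y.2.2 := Primrec.snd.comp Primrec.snd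
      have h4 := Primrec.snd.comp h2
      exact ((SigmaOne.mem_finite bin.toFinite).comp h2).and
        ((SigmaOne.eq (Primrec.fst.comp h1)
          (Primrec.list_cons.comp (Primrec.fst.comp h2) h3)).and
        (SigmaOne.eq (Primrec.snd.comp Primrec.fst)
          ((Primrec.list_cons.comp (Primrec.fst.comp h4)
            (Primrec.list_cons.comp (Primrec.snd.comp h4) h3)).pair (Primrec.snd.comp h1))))
  refine (hstep.reflTransGen.comp (f := fun x : I × FreeMonoid X => (([x.1], 1), ([], x.2)))
    ?_).of_eq fun x => gen_iff_reflTransGen.symm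
  exact ((Primrec.list_cons.comp Primrec.fst (Primrec.const [])).pair (Primrec.const 1)).pair
    ((Primrec.const []).pair Primrec.snd)

theorem primrecPred_finite {α : Type*} [Primcodable α] [Finite α] (p : α → Prop) :
    PrimrecPred p := by
  classical
  exact Primrec.primrecPred (Primrec.dom_finite _)

/-- The quantifier over all generated words is traded, by `not_rel_gen_iff`, for a search for a list
`Q` whose required properties are decidable. -/
theorem sigmaOne_separates {con : Set (I × FreeMonoid X)} (hcon : con.Finite)
    (bin : Set (I × I × I)) (start : Set I) :
    SigmaOne fun x : (ℕ × List ℕ) × FreeMonoid X =>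
      ∀ i ∈ start, ∀ u, Gen con bin i u → ¬ autCon x.1 u x.2 := by
  have := hcon.to_subtype
  have hc {γ : Type _} [Primcodable γ] : Primrec fun y : ((ℕ × List ℕ) × FreeMonoid X) × γ =>
    y.1.1 := Primrec.fst.comp Primrec.fst
  have fs {γ δ ε : Type _} [Primcodable γ] [Primcodable δ] [Primcodable ε] :
    Primrec fun y : γ × δ × ε => y.2.1 := Primrec.fst.comp Primrec.snd
  have ss {γ δ ε : Type _} [Primcodable γ] [Primcodable δ] [Primcodable ε] :
    Primrec fun y : γ × δ × ε => y.2.2 := Primrec.snd.comp Primrec.snd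
  refine (SigmaOne.exists_ (β := List (I × FreeMonoid X)) ?_).of_eq fun x =>
    (not_rel_gen_iff (autCon x.1) x.2).symm
  refine .and (.forall_finite fun c => ?_) (.and (.forall_finite fun b => ?_) ?_)
  · refine .exists_mem Primrec.snd (.and (.eq fs (Primrec.const _)) (.of_primrecPred ?_))
    exact primrecPred_autCon (hc.comp Primrec.fst) ss (Primrec.const _)
  · refine .forall_mem Primrec.snd (.forall_mem (Primrec.snd.comp Primrec.fst) (.or ?_ (.or ?_ ?_)))
    · exact .of_primrecPred
        (Primrec.eq.comp (fs.comp Primrec.fst) (Primrec.const _)).not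
    · exact .of_primrecPred (Primrec.eq.comp fs (Primrec.const _)).not
    · refine .exists_mem (Primrec.snd.comp (Primrec.fst.comp Primrec.fst))
        (.and (.eq fs (Primrec.const _)) (.of_primrecPred ?_))
      exact primrecPred_autCon (hc.comp (Primrec.fst.comp (Primrec.fst.comp Primrec.fst))) ss
        (primrec_freeMonoid_mul (ss.comp (Primrec.fst.comp Primrec.fst)) (ss.comp Primrec.fst))
  · refine .forall_mem Primrec.snd (.or (.of_primrecPred ?_) (.of_primrecPred ?_))
    · exact ((primrecPred_finite (· ∈ start)).comp fs).not
    · exact (primrecPred_autCon (hc.comp Primrec.fst) ss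
        (Primrec.snd.comp (Primrec.fst.comp Primrec.fst))).not

end Systems

/-! ### Certifying that an automaton respects the presentation. -/

section InversePresentation

variable {α : Type*}

theorem InvWord.inv_mul (u v : InvWord α) : (u * v).inv = v.inv * u.inv := by
  simp [InvWord.inv, FreeMonoid.toList_mul, FreeMonoid.ofList_append]

variable {R : Set (InvWord α × InvWord α)}

/-- A congruence of finite index respects the inverse presentation if and only if it does so for
a finite set of words that represents all the classes of a word together with its inverse. -/
theorem conGen_invRel_le_iff (d : Con (InvWord α)) [Finite d.Quotient] :
    conGen (InvRel R) ≤ d ↔ (∀ r : R, d r.1.1 r.1.2) ∧ ∃ P : List (InvWord α),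
      (∃ p ∈ P, d p 1 ∧ d p.inv 1) ∧
      (∀ x : α × Bool, ∀ p ∈ P, ∃ q ∈ P,
        d q (.of x * p) ∧ d q.inv (p.inv * InvWord.inv (.of x))) ∧
      (∀ p ∈ P, d (p * p.inv * p) p) ∧
      ∀ p ∈ P, ∀ q ∈ P, d (p * p.inv * (q * q.inv)) (q * q.inv * (p * p.inv)) := by
  rw [Con.conGen_le]
  constructor
  · intro h
    -- Formal inversion need not be compatible with `d`, so the class of the inverse is recorded
    -- together with the class of the word.
    obtain ⟨P, -, hP⟩ := exists_list_representatives (fun _ : InvWord α => True)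
      (fun p => ((p : d.Quotient), (p.inv : d.Quotient)))
    have hP' : ∀ w, ∃ p ∈ P, d p w ∧ d p.inv w.inv := fun w => by
      obtain ⟨p, hp, he⟩ := hP w trivial
      exact ⟨p, hp, (Con.eq d).1 (Prod.mk.inj he).1, (Con.eq d).1 (Prod.mk.inj he).2⟩
    refine ⟨fun r => h _ _ (.rel _ _ r.2), P, hP' 1, fun x p _ => ?_,
      fun p _ => h _ _ (.regular p), fun p _ q _ => h _ _ (.commute p q)⟩
    obtain ⟨q, hq, h₁, h₂⟩ := hP' (.of x * p)
    exact ⟨q, hq, h₁, by rwa [InvWord.inv_mul] at h₂⟩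
  · rintro ⟨hR, P, hone, hof, hreg, hcomm⟩
    -- Closure of `P` under prepending a letter, up to `d` on both coordinates, carries
    -- representatives from the empty word to all words.
    have hP : ∀ w, ∃ p ∈ P, d p w ∧ d p.inv w.inv := fun w => by
      induction w using FreeMonoid.inductionOn' with
      | one => exact hone
      | of_mul x w ih =>
        obtain ⟨p, hp, h₁, h₂⟩ := ih
        obtain ⟨q, hq, h₃, h₄⟩ := hof x p hp
        refine ⟨q, hq, d.trans h₃ (d.mul (d.refl _) h₁), ?_⟩
        rw [InvWord.inv_mul]
        exact d.trans h₄ (d.mul h₂ (d.refl _))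
    intro u v huv
    cases huv with
    | regular w =>
      obtain ⟨p, hp, h₁, h₂⟩ := hP v
      exact d.trans (d.symm (d.mul (d.mul h₁ h₂) h₁)) (d.trans (hreg p hp) h₁)
    | commute w v =>
      obtain ⟨p, hp, h₁, h₂⟩ := hP w
      obtain ⟨q, hq, h₃, h₄⟩ := hP v
      exact d.trans (d.symm (d.mul (d.mul h₁ h₂) (d.mul h₃ h₄)))
        (d.trans (hcomm p hp q hq) (d.mul (d.mul h₃ h₄) (d.mul h₁ h₂)))
    | rel w v h => exact hR ⟨_, h⟩

variable [Primcodable α] [Finite α]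

theorem primrec_inv : Primrec (InvWord.inv : InvWord α → InvWord α) :=
  primrec_ofList.comp (Primrec.list_reverse.comp (Primrec.list_map primrec_toList
    ((Primrec.dom_finite fun x : α × Bool => (x.1, !x.2)).comp Primrec.snd)))

theorem sigmaOne_invRel (hR : R.Finite) :
    SigmaOne fun x : InvWord α × InvWord α => InvRel R x.1 x.2 := by
  have h1 : Primrec fun y : (InvWord α × InvWord α) × InvWord α × InvWord α =>
      y.2.1 * y.2.1.inv := primrec_freeMonoid_mul (Primrec.fst.comp Primrec.snd)
    (primrec_inv.comp (Primrec.fst.comp Primrec.snd))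
  have h2 : Primrec fun y : (InvWord α × InvWord α) × InvWord α × InvWord α =>
      y.2.2 * y.2.2.inv := primrec_freeMonoid_mul (Primrec.snd.comp Primrec.snd)
    (primrec_inv.comp (Primrec.snd.comp Primrec.snd))
  have hreg : SigmaOne fun x : InvWord α × InvWord α => x.1 = x.2 * x.2.inv * x.2 :=
    .eq Primrec.fst (primrec_freeMonoid_mul (primrec_freeMonoid_mul Primrec.snd
      (primrec_inv.comp Primrec.snd)) Primrec.snd)
  have hcomm : SigmaOne fun x : InvWord α × InvWord α =>
      ∃ z : InvWord α × InvWord α, x.1 = z.1 * z.1.inv * (z.2 * z.2.inv) ∧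
        x.2 = z.2 * z.2.inv * (z.1 * z.1.inv) :=
    .exists_ (.and (.eq (Primrec.fst.comp Primrec.fst) (primrec_freeMonoid_mul h1 h2))
      (.eq (Primrec.snd.comp Primrec.fst) (primrec_freeMonoid_mul h2 h1)))
  refine (hreg.or (hcomm.or (SigmaOne.mem_finite hR))).of_eq ?_
  rintro ⟨u, v⟩
  constructor
  · rintro (h | ⟨⟨p, q⟩, h, h'⟩ | h)
    · simp only at h
      rw [h]
      exact .regular v
    · simp only at h h'
      rw [h, h']
      exact .commute p q
    · exact .rel u v h
  · intro (h : InvRel R u v)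
    cases h with
    | regular => exact .inl rfl
    | commute p q => exact .inr (.inl ⟨(p, q), rfl, rfl⟩)
    | rel _ _ h => exact .inr (.inr h)

theorem sigmaOne_conGen_invRel_le (hR : R.Finite) :
    SigmaOne fun c : ℕ × List ℕ => conGen (InvRel R) ≤ autCon c := by
  have := hR.to_subtype
  refine (SigmaOne.and (.forall_finite fun r => .of_primrecPred
    (primrecPred_autCon Primrec.id (Primrec.const _) (Primrec.const _)))
    (.exists_ (.and ?_ (.and (.forall_finite fun x => ?_) (.and ?_ ?_))))).of_eq
      fun c => (conGen_invRel_le_iff (autCon c)).symm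
  · exact .exists_mem Primrec.snd (.and
      (.of_primrecPred (primrecPred_autCon (Primrec.fst.comp Primrec.fst) Primrec.snd
        (Primrec.const _)))
      (.of_primrecPred (primrecPred_autCon (Primrec.fst.comp Primrec.fst)
        (primrec_inv.comp Primrec.snd) (Primrec.const _))))
  · refine .forall_mem Primrec.snd (.exists_mem (Primrec.snd.comp Primrec.fst) (.and
      (.of_primrecPred (primrecPred_autCon (Primrec.fst.comp (Primrec.fst.comp Primrec.fst))
        Primrec.snd ?_))
      (.of_primrecPred (primrecPred_autCon (Primrec.fst.comp (Primrec.fst.comp Primrec.fst))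
        (primrec_inv.comp Primrec.snd) ?_))))
    · exact primrec_freeMonoid_mul (Primrec.const _) (Primrec.snd.comp Primrec.fst)
    · exact primrec_freeMonoid_mul (primrec_inv.comp (Primrec.snd.comp Primrec.fst))
        (Primrec.const _)
  · exact .forall_mem Primrec.snd (.of_primrecPred (primrecPred_autCon
      (Primrec.fst.comp Primrec.fst)
      (primrec_freeMonoid_mul (primrec_freeMonoid_mul Primrec.snd (primrec_inv.comp Primrec.snd))
        Primrec.snd) Primrec.snd))
  · have h1 : Primrec fun y : (((ℕ × List ℕ) × List (InvWord α)) × InvWord α) × InvWord α =>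
        y.1.2 * y.1.2.inv := primrec_freeMonoid_mul (Primrec.snd.comp Primrec.fst)
      (primrec_inv.comp (Primrec.snd.comp Primrec.fst))
    have h2 : Primrec fun y : (((ℕ × List ℕ) × List (InvWord α)) × InvWord α) × InvWord α =>
        y.2 * y.2.inv := primrec_freeMonoid_mul Primrec.snd (primrec_inv.comp Primrec.snd)
    exact .forall_mem Primrec.snd (.forall_mem (Primrec.snd.comp Primrec.fst)
      (.of_primrecPred (primrecPred_autCon (Primrec.fst.comp (Primrec.fst.comp Primrec.fst))
        (primrec_freeMonoid_mul h1 h2) (primrec_freeMonoid_mul h2 h1))))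

end InversePresentation

/-! ### Separating an element by a finite quotient. -/

section FiniteJAbove

variable {M : Type*} [Monoid M]

theorem IsFactor.left {a b m : M} (h : IsFactor (a * b) m) : IsFactor a m := by
  obtain ⟨x, y, rfl⟩ := h
  exact ⟨x, b * y, by simp [mul_assoc]⟩

theorem IsFactor.right {a b m : M} (h : IsFactor (a * b) m) : IsFactor b m := by
  obtain ⟨x, y, rfl⟩ := h
  exact ⟨x * a, y, by simp [mul_assoc]⟩

theorem IsFactor.refl (m : M) : IsFactor m m := ⟨1, 1, by simp⟩

/-- The congruence that collapses the ideal of the elements that are not factors of `m`. -/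
def nonFactorCon (m : M) : Con M where
  r a b := a = b ∨ ¬ IsFactor a m ∧ ¬ IsFactor b m
  iseqv := ⟨fun _ => .inl rfl, fun h => h.imp Eq.symm And.symm, by
    rintro a b c (rfl | h) (rfl | h')
    · exact .inl rfl
    · exact .inr h'
    · exact .inr h
    · exact .inr ⟨h.1, h'.2⟩⟩
  mul' := by
    rintro a b c d (rfl | h) (rfl | h')
    · exact .inl rfl
    · exact .inr ⟨fun h => h'.1 h.right, fun h => h'.2 h.right⟩
    · exact .inr ⟨fun h' => h.1 h'.left, fun h' => h.2 h'.left⟩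
    · exact .inr ⟨fun h' => h.1 h'.left, fun h' => h.2 h'.left⟩

theorem nonFactorCon_self {a m : M} : nonFactorCon m a m ↔ a = m :=
  ⟨fun h => h.elim id fun h => absurd (IsFactor.refl m) h.2, .inl⟩

/-- Pull back `nonFactorCon m` along `π`. Its classes are determined by the finitely many factors of
`m` plus one class for everything else, and `m`, a factor of itself, is equivalent only to itself.
-/
theorem FiniteJAbove.exists_con {N : Type*} [Monoid N] (hfin : FiniteJAbove M) (π : N →* M)
    (m : M) : ∃ d : Con N, Finite d.Quotient ∧ (∀ u v, π u = π v → d u v) ∧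
      ∀ u v, π v = m → d u v → π u = m := by
  classical
  refine ⟨(nonFactorCon m).comap π (map_mul π), ?_, fun u v h => .inl h, fun u v hv h => ?_⟩
  · have := (hfin m).to_subtype
    let f : N → Option {w : M | IsFactor w m} := fun u =>
      if h : IsFactor (π u) m then some ⟨π u, h⟩ else none
    have hf : ∀ u v, nonFactorCon m (π u) (π v) ↔ f u = f v := fun u v => by
      change (π u = π v ∨ ¬ IsFactor (π u) m ∧ ¬ IsFactor (π v) m) ↔ _
      by_cases hu : IsFactor (π u) m <;> by_cases hv : IsFactor (π v) m
      · simp [f, hu, hv]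
      · simp only [f, hu, hv, dif_pos, dif_neg, not_false_eq_true]
        simp only [not_true, false_and, or_false, reduceCtorEq, iff_false]
        exact fun h => hv (h ▸ hu)
      · simp only [f, hu, hv, dif_pos, dif_neg, not_false_eq_true]
        simp only [not_true, and_false, or_false, reduceCtorEq, iff_false]
        exact fun h => hu (h ▸ hv)
      · simp [f, hu, hv]
    refine Finite.of_injective (Quotient.lift f fun u v h => (hf u v).1 h :
      ((nonFactorCon m).comap π (map_mul π)).Quotient → _) ?_
    rintro ⟨u⟩ ⟨v⟩ h
    exact Quotient.sound ((hf u v).2 h)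
  · have : nonFactorCon m (π u) (π v) := h
    rw [hv] at this
    exact nonFactorCon_self.1 this

end FiniteJAbove

/-! ### The decision procedure. -/

section Membership

variable {M : Type*} [Monoid M]

theorem HasFiniteInvPresentation.exists_hom (hpres : HasFiniteInvPresentation M) :
    ∃ (n : ℕ) (R : Set (InvWord (Fin n) × InvWord (Fin n))) (π : InvWord (Fin n) →* M),
      R.Finite ∧ Function.Surjective π ∧ ∀ u v, conGen (InvRel R) u v ↔ π u = π v := by
  obtain ⟨n, R, hR, ⟨e⟩⟩ := hpres
  refine ⟨n, R, e.toMonoidHom.comp (PresentedMonoid.mk _), hR,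
    e.surjective.comp PresentedMonoid.surjective_mk, fun u v => ?_⟩
  rw [← PresentedMonoid.mk_eq_mk_iff]
  exact e.injective.eq_iff.symm

theorem computablePred_exists_gen {n : ℕ} {R : Set (InvWord (Fin n) × InvWord (Fin n))}
    (hR : R.Finite) {π : InvWord (Fin n) →* M}
    (hπ : ∀ u v, conGen (InvRel R) u v ↔ π u = π v) (hfin : FiniteJAbove M)
    {I : Type*} [Finite I] {con : Set (I × InvWord (Fin n))} (hcon : con.Finite)
    (bin : Set (I × I × I)) (start : Set I) :
    ComputablePred fun w : InvWord (Fin n) =>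
      ∃ i ∈ start, ∃ u, Gen con bin i u ∧ π u = π w := by
  obtain ⟨r, ⟨e⟩⟩ := Finite.exists_equiv_fin I
  let : Primcodable I := Primcodable.ofEquiv (Fin r) e
  refine SigmaOne.computablePred ?_ ?_
  · refine .exists_ (.and (.comp (.of_primrecPred (primrecPred_finite (· ∈ start))) Primrec.snd)
      (.exists_ (.and ?_ ?_)))
    · exact (sigmaOne_gen hcon bin).comp ((Primrec.snd.comp Primrec.fst).pair Primrec.snd)
    · exact ((sigmaOne_conGen (sigmaOne_invRel hR)).comp
        (Primrec.snd.pair (Primrec.fst.comp Primrec.fst))).of_eq fun x => hπ _ _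
  -- The certificate of non-membership is an automaton that factors through `M` and separates `w`
  -- from all generated words.
  · have h : SigmaOne fun w : InvWord (Fin n) => ∃ c : ℕ × List ℕ,
        conGen (InvRel R) ≤ autCon c ∧ ∀ i ∈ start, ∀ u, Gen con bin i u → ¬ autCon c u w :=
      .exists_ (((sigmaOne_conGen_invRel_le hR).comp Primrec.snd).and
        ((sigmaOne_separates hcon bin start).comp (Primrec.snd.pair Primrec.fst)))
    refine h.of_eq fun w => ⟨?_, fun hw => ?_⟩
    · rintro ⟨c, hc, hsep⟩ ⟨i, hi, u, hu, huw⟩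
      exact hsep i hi u hu (Con.le_def.1 hc ((hπ u w).2 huw))
    · obtain ⟨d, hd, hle, hm⟩ := hfin.exists_con π (π w)
      obtain ⟨c, rfl⟩ := exists_autCon_eq d
      exact ⟨c, Con.le_def.2 fun huv => hle _ _ ((hπ _ _).1 huv),
        fun i hi u hu huw => hw ⟨i, hi, u, hu, hm u w rfl huw⟩⟩

theorem membershipSolvable_of_gen (hpres : HasFiniteInvPresentation M) (hfin : FiniteJAbove M)
    {I : Type*} [Finite I] {con : Set (I × M)} (hcon : con.Finite) (bin : Set (I × I × I))
    (start : Set I) : MembershipSolvable {m | ∃ i ∈ start, Gen con bin i m} := by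
  obtain ⟨n, R, π, hR, hsurj, hπ⟩ := hpres.exists_hom
  refine ⟨Monoid.fg_of_surjective π hsurj, fun k g _ => ?_⟩
  obtain ⟨σ, hσ⟩ := hsurj.hasRightInverse
  -- The constants are lifted to words along the section `σ`, so that the system can be solved in
  -- the free monoid.
  have hcon' : con = Prod.map id π '' (Prod.map id σ '' con) := by
    rw [← Set.image_comp, Prod.map_comp_map, hσ.comp_eq_id]
    simp
  -- Substituting a fixed word for each given generator reduces the problem to the generators of the
  -- presentation.
  let tr : List (Fin k) → InvWord (Fin n) := fun w =>
    FreeMonoid.ofList (w.flatMap fun j => (σ (g j)).toList)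
  have htr : Primrec tr := primrec_ofList.comp (Primrec.list_flatMap Primrec.id
    ((Primrec.dom_finite fun j => (σ (g j)).toList).comp Primrec.snd))
  have hval : ∀ w, π (tr w) = (w.map g).prod := fun w => by
    induction w with
    | nil => exact map_one π
    | cons j w ih =>
      have : tr (j :: w) = σ (g j) * tr w := rfl
      rw [this, map_mul, hσ, ih, List.map_cons, List.prod_cons]
  obtain ⟨_, h⟩ := computablePred_exists_gen hR hπ hfin (hcon.image (Prod.map id σ)) bin start
  refine ComputablePred.of_eq ⟨fun w => inferInstance, h.comp htr.to_comp⟩ fun w => ?_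
  rw [hcon']
  simp only [Set.mem_ofPred_eq, gen_image_iff, hval]
  rw [← hcon']

theorem IsAlgebraicSubset.membershipSolvable (hpres : HasFiniteInvPresentation M)
    (hfin : FiniteJAbove M) {S : Set M} (hS : IsAlgebraicSubset S) : MembershipSolvable S := by
  obtain ⟨I, _, con, bin, start, hcon, rfl⟩ := hS
  exact membershipSolvable_of_gen hpres hfin hcon bin start

end Membership

end InvMon

theorem corollary3p11 {M : Type*} [Monoid M]
    (hinv : InvMon.IsInverseMonoid M)
    (hpres : InvMon.HasFiniteInvPresentation M)
    (hfin : InvMon.FiniteJAbove M) :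
    (∀ (A : Type*) [Finite A] (φ : FreeMonoid A →* M) (L : Language A),
      L.IsContextFree → InvMon.MembershipSolvable (InvMon.languageImage φ L)) ∧
    (∀ S : Set M, InvMon.IsRationalSubset S → InvMon.MembershipSolvable S) ∧
    (∀ N : Submonoid M, N.FG → InvMon.MembershipSolvable (N : Set M)) := by
  refine ⟨fun A _ φ L hL => ?_, fun S hS => hS.isAlgebraicSubset.membershipSolvable hpres hfin,
    fun N hN => ?_⟩
  · obtain ⟨I, _, con, bin, start, hcon, h⟩ := InvMon.exists_gen_of_isContextFree φ hL
    rw [h]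
    exact InvMon.membershipSolvable_of_gen hpres hfin hcon bin start
  · obtain ⟨s, rfl⟩ := hN
    exact (InvMon.IsAlgebraicSubset.of_finite s.finite_toSet).closure.membershipSolvable hpres hfin
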